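/- **Setting.** Let $\mathcal T=(\mathbb T,V,\xi)$ be a strict topological theory: $V=(V,\otimes,k)$ is a commutative unital quantale with internal hom $\hom$; $\mathbb T=(T,e,m)$ is a monad on $\mathbf{Set}$ such that $T$ sends pullbacks to weak pullbacks and every naturality square of $m$ is a weak pullback; $\xi:TV\to V$ is a $\mathbb T$-algebra structure for which $\otimes:V\times V\to V$ and $k:1\to V$ are $\mathbb T$-homomorphisms, and $\varphi\mapsto\xi\cdot T\varphi$ is a (monotone) natural transformation $P\to PT$, where $PX=V^X$ and $Pf(\varphi)(y)=\bigvee_{f(x)=y}\varphi(x)$. For $r:X\times Y\to V$ let $T_\xi r(\mathfrak x,\mathfrak y)=\bigvee\{\xi\cdot Tr(\mathfrak w)\mid \mathfrak w\in T(X\times Y),\,T\pi_1\mathfrak w=\mathfrak x,\,T\pi_2\mathfrak w=\mathfrak y\}$. For $\alpha:TX\times Y\to V$ and $\beta:TY\times Z\to V$ put $\hat\alpha(\mathfrak x,\mathfrak y)=\bigvee_{m_X(\mathfrak X)=\mathfrak x}T_\xi\alpha(\mathfrak X,\mathfrak y)$ and $(\beta\circ\alpha)(\mathfrak x,z)=\bigvee_{\mathfrak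 y\in TY}\hat\alpha(\mathfrak x,\mathfrak y)\otimes\beta(\mathfrak y,z)$; for $\gamma:TX\times Z\to V$ the extension of $\gamma$ along $\alpha$ is $(\gamma/\alpha)(\mathfrak y,z)=\bigwedge_{\mathfrak x\in TX}\hom(\hat\alpha(\mathfrak x,\mathfrak y),\gamma(\mathfrak x,z))$. A $\mathcal T$-category is a set $X$ with $a:TX\times X\to V$ satisfying $k\le a(e_X(x),x)$ and $T_\xi a(\mathfrak X,\mathfrak x)\otimes a(\mathfrak x,x)\le a(m_X(\mathfrak X),x)$. A $\mathcal T$-functor $f:(X,a)\to(Y,b)$ is a map with $a(\mathfrak x,x)\le b(Tf(\mathfrak x),f(x))$. A $\mathcal T$-distributor from $(X,a)$ to $(Y,b)$ is a map $\varphi:TX\times Y\to V$ with $\varphi\circ a\le\varphi$ and $b\circ\varphi\le\varphi$. For a $\mathcal T$-functor $f:(X,a)\to(Y,b)$ put $f_*(\mathfrak x,y)=b(Tf(\mathfrak x),y)$ (a distributor from $X$ to $Y$) and $f^*(\mathfrak y,x)=b(\mathfrak y,f(x))$ (a distributor from $Y$ to $X$). For $\mathcal T$-functors $f,g:X\to Y$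 write $f\le g$ if $f^*\le g^*$ pointwise, and $f\cong g$ if $f\le g\le f$; write $f\dashv g$ for $f:X\to Y$, $g:Y\to X$ if $1_X\le g f$ and $f g\le 1_Y$. Let $G=(1,e_1^\circ)$, where $e_1^\circ(\mathfrak t,*)$ is $k$ if $\mathfrak t=e_1(*)$ and $\bot$ otherwise. Let $\Phi$ be a class of $\mathcal T$-distributors such that: $f^*\in\Phi$ for every $\mathcal T$-functor $f$; if $\varphi\in\Phi$ and $f$ is a $\mathcal T$-functor, then $f^*\circ\varphi\in\Phi$, $\varphi\circ f^*\in\Phi$, and $\varphi\circ f_*\in\Phi$ provided $f_*\in\Phi$, whenever these composites are defined; and a distributor $\varphi$ from $X$ to $Y$ is in $\Phi$ as soon as $y^*\circ\varphi\in\Phi$ for all $y\in Y$, where $y$ is regarded as a $\mathcal T$-functor $G\to Y$. A colimit of a $\mathcal T$-functor $h:Y\to X$ weighted by a distributor $\varphi$ from $Y$ to $Z$ is a $\mathcal T$-functor $g:Z\to X$ with $g_*=h_*/\varphi$. $X$ is *$\Phi$-cocomplete* if all colimits in $X$ with weight in $\Phi$ exist. A $\mathcal T$-functor $f$ with domain $X$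 is *$\Phi$-cocontinuous* if, whenever $\varphi\in\Phi$ and $g$ is a $\varphi$-weighted colimit of $h$ in $X$, $f g$ is a $\varphi$-weighted colimit of $f h$. $f$ is *$\Phi$-dense* if $f_*\in\Phi$, and a *left adjoint* if $f\dashv g$ for some $\mathcal T$-functor $g$. Let $|X|=(TX,m_X)$. The set $V^{|X|}$ of all $\psi:TX\to V$ such that $\xi\cdot T(\psi\cdot\pi_1)(\mathfrak w)\le\psi(m_X(T\pi_1\mathfrak w))$ for all $\mathfrak w\in T(TX\times1)$ with $T\pi_2\mathfrak w=e_1(*)$ (i.e. the $\mathcal T$-functors $|X|\otimes G\to V$) is a $\mathcal T$-category with structure $[\![\mathfrak p,\psi]\!]=\bigwedge\{\hom(\xi\cdot T\mathrm{ev}(\mathfrak q),\psi(m_X\cdot T\pi_1(\mathfrak q)))\mid\mathfrak q\in T(TX\times V^{|X|}),\,T\pi_2\mathfrak q=\mathfrak p\}$. $\mathcal PX$ is its subcategory of those $\psi$ that are distributors from $X$ to $G$, and $\Phi X$ is the subcategory of $\mathcal PX$ of those $\psi$ that belong to $\Phi$. Let $\mathsf y^\Phi_X:X\to\Phi X$,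 $x\mapsto a(-,x)$, and, for a $\mathcal T$-functor $f:X\to Y$, let $\Phi f:\Phi X\to\Phi Y$, $\psi\mapsto\psi\circ f^*$; both are $\mathcal T$-functors. **Proposition.** Let $f:X\to Y$ be a $\mathcal T$-functor between $\Phi$-cocomplete $\mathcal T$-categories. Then $\mathsf y^\Phi_X$ and $\mathsf y^\Phi_Y$ have left adjoints, and for all left adjoints $\mathrm{Sup}^\Phi_X\dashv\mathsf y^\Phi_X$ and $\mathrm{Sup}^\Phi_Y\dashv\mathsf y^\Phi_Y$ (these are unique up to $\cong$): 1. $f$ is $\Phi$-cocontinuous if and only if $f\cdot\mathrm{Sup}^\Phi_X\cong\mathrm{Sup}^\Phi_Y\cdot\Phi f$. 2. If $f$ is $\Phi$-cocontinuous, then $f$ is $\Phi$-dense if and only if $f$ is a left adjoint. -/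

import Mathlib

universe u

open scoped Quantale

/-! ### Elementwise access to a monad on the category of sets -/

section SetMonad

variable (T : CategoryTheory.Monad (Type u))

/-- The action `T f : T X → T Y` of the monad on a function. -/
def tmap {X Y : Type u} (f : X → Y) : T.obj X → T.obj Y :=
  T.map (TypeCat.ofHom f)

/-- The unit `e_X : X → T X`. -/
def tunit (X : Type u) : X → T.obj X := T.η.app X

/-- The multiplication `m_X : T T X → T X`. -/
def tmul (X : Type u) : T.obj (T.obj X) → T.obj X := T.μ.app X

variable {T} {X Y Z : Type u}

theorem tmap_id (x : T.obj X) : tmap T (fun y : X => y) x = x :=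
  CategoryTheory.ConcreteCategory.congr_hom (T.map_id X) x

theorem tmap_tmap (g : Y → Z) (f : X → Y) (x : T.obj X) :
    tmap T g (tmap T f x) = tmap T (fun y => g (f y)) x :=
  (CategoryTheory.ConcreteCategory.congr_hom
    (T.map_comp (TypeCat.ofHom f) (TypeCat.ofHom g)) x).symm

theorem tmap_tunit (f : X → Y) (x : X) : tmap T f (tunit T X x) = tunit T Y (f x) :=
  (CategoryTheory.ConcreteCategory.congr_hom (T.η.naturality (TypeCat.ofHom f)) x).symm

theorem tmul_tmap_tmap (f : X → Y) (x : T.obj (T.obj X)) :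
    tmul T Y (tmap T (tmap T f) x) = tmap T f (tmul T X x) :=
  CategoryTheory.ConcreteCategory.congr_hom (T.μ.naturality (TypeCat.ofHom f)) x

theorem tmul_tmap_tmul (x : T.obj (T.obj (T.obj X))) :
    tmul T X (tmap T (tmul T X) x) = tmul T X (tmul T (T.obj X) x) :=
  CategoryTheory.ConcreteCategory.congr_hom (T.assoc X) x

theorem tmul_tunit (x : T.obj X) : tmul T X (tunit T (T.obj X) x) = x :=
  CategoryTheory.ConcreteCategory.congr_hom (T.left_unit X) x

theorem tmul_tmap_tunit (x : T.obj X) : tmul T X (tmap T (tunit T X) x) = x :=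
  CategoryTheory.ConcreteCategory.congr_hom (T.right_unit X) x

end SetMonad

/-- The square `f ∘ p = g ∘ q` of functions commutes and is a pullback. -/
def IsPullbackSq {P X Y Z : Type u} (p : P → X) (q : P → Y) (f : X → Z) (g : Y → Z) : Prop :=
  (∀ w, f (p w) = g (q w)) ∧ ∀ x y, f x = g y → ∃! w, p w = x ∧ q w = y

/-- The square `f ∘ p = g ∘ q` of functions commutes and is a weak pullback. -/
def IsWeakPullbackSq {P X Y Z : Type u} (p : P → X) (q : P → Y) (f : X → Z) (g : Y → Z) : Prop :=
  (∀ w, f (p w) = g (q w)) ∧ ∀ x y, f x = g y → ∃ w, p w = x ∧ q w = y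

/-- The `V`-powerset functor on functions: `(P f φ)(y) = ⋁ {φ x ∣ f x = y}`. -/
def powMap {V : Type u} [CompleteLattice V] {X Y : Type u} (f : X → Y) (φ : X → V) : Y → V :=
  fun y => ⨆ (x : X) (_ : f x = y), φ x

/-- A strict topological theory `(T, V, ξ)` over a commutative unital quantale `V`
with tensor `*` and neutral element `1`. -/
structure TopTheory (V : Type u) [CommMonoid V] [CompleteLattice V] [IsQuantale V] where
  /-- the monad on sets -/
  T : CategoryTheory.Monad (Type u)
  /-- `T` sends pullbacks to weak pullbacks -/
  map_pullback : ∀ {P X Y Z : Type u} (p : P → X) (q : P → Y) (f : X → Z) (g : Y → Z),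
    IsPullbackSq p q f g → IsWeakPullbackSq (tmap T p) (tmap T q) (tmap T f) (tmap T g)
  /-- the naturality squares of `m` are weak pullbacks -/
  mul_pullback : ∀ {X Y : Type u} (f : X → Y),
    IsWeakPullbackSq (tmap T (tmap T f)) (tmul T X) (tmul T Y) (tmap T f)
  /-- the structure map of `V` -/
  xi : T.obj V → V
  xi_unit : ∀ v : V, xi (tunit T V v) = v
  xi_mul : ∀ v : T.obj (T.obj V), xi (tmap T xi v) = xi (tmul T V v)
  /-- `k : 1 → V` is a homomorphism of algebras -/
  xi_one : ∀ t : T.obj PUnit.{u + 1}, xi (tmap T (fun _ => (1 : V)) t) = 1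
  /-- `⊗ : V × V → V` is a homomorphism of algebras -/
  xi_tensor : ∀ w : T.obj (V × V),
    xi (tmap T (fun p : V × V => p.1 * p.2) w) = xi (tmap T Prod.fst w) * xi (tmap T Prod.snd w)
  /-- `φ ↦ ξ ∘ T φ` is monotone -/
  xi_mono : ∀ {X : Type u} (φ ψ : X → V), φ ≤ ψ → ∀ x : T.obj X,
    xi (tmap T φ x) ≤ xi (tmap T ψ x)
  /-- `φ ↦ ξ ∘ T φ` is natural with respect to the `V`-powerset functor -/
  xi_nat : ∀ {X Y : Type u} (f : X → Y) (φ : X → V) (y : T.obj Y),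
    xi (tmap T (powMap f φ) y) = powMap (tmap T f) (fun x => xi (tmap T φ x)) y

namespace TopTheory

variable {V : Type u} [CommMonoid V] [CompleteLattice V] [IsQuantale V] (𝕋 : TopTheory V)

/-- `ξ_X φ = ξ ∘ T φ`. -/
def xiMap {X : Type u} (φ : X → V) : 𝕋.T.obj X → V := fun x => 𝕋.xi (tmap 𝕋.T φ x)

/-- The extension of a `V`-relation `r : X ⇸ Y` to a `V`-relation `T X ⇸ T Y`. -/
def relExt {X Y : Type u} (r : X → Y → V) : 𝕋.T.obj X → 𝕋.T.obj Y → V := fun x y =>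
  ⨆ (w : 𝕋.T.obj (X × Y)) (_ : tmap 𝕋.T Prod.fst w = x ∧ tmap 𝕋.T Prod.snd w = y),
    𝕋.xiMap (fun p : X × Y => r p.1 p.2) w

/-- For a `𝕋`-relation `α : T X ⇸ Y`, the `V`-relation `T_ξ α · m_X° : T X ⇸ T Y`. -/
def klExt {X Y : Type u} (α : 𝕋.T.obj X → Y → V) : 𝕋.T.obj X → 𝕋.T.obj Y → V := fun x y =>
  ⨆ (xx : 𝕋.T.obj (𝕋.T.obj X)) (_ : tmul 𝕋.T X xx = x), 𝕋.relExt α xx y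

/-- Kleisli convolution `β ∘ α = β · T_ξ α · m_X°`. -/
def kcomp {X Y Z : Type u} (β : 𝕋.T.obj Y → Z → V) (α : 𝕋.T.obj X → Y → V) :
    𝕋.T.obj X → Z → V := fun x z =>
  ⨆ y : 𝕋.T.obj Y, 𝕋.klExt α x y * β y z

/-- The extension of `γ : X ⇀ Z` along `α : X ⇀ Y`: the right adjoint of `- ∘ α` at `γ`. -/
def kextend {X Y Z : Type u} (γ : 𝕋.T.obj X → Z → V) (α : 𝕋.T.obj X → Y → V) :
    𝕋.T.obj Y → Z → V := fun y z =>
  ⨅ x : 𝕋.T.obj X, 𝕋.klExt α x y ⇨ₗ γ x z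

/-- The `𝕋`-relation `e_X°`: value `k` at `(e_X x, x)` and `⊥` elsewhere. -/
def unitRel (X : Type u) : 𝕋.T.obj X → X → V := fun x' x => ⨆ (_ : tunit 𝕋.T X x = x'), 1

/-- The structure of the free algebra `(T X, m_X)` as a `𝕋`-relation. -/
def freeRel (X : Type u) : 𝕋.T.obj (𝕋.T.obj X) → 𝕋.T.obj X → V :=
  fun xx x => ⨆ (_ : tmul 𝕋.T X xx = x), 1

/-- The structure of the tensor product of two `𝕋`-categories. -/
def tensorRel {X Y : Type u} (a : 𝕋.T.obj X → X → V) (b : 𝕋.T.obj Y → Y → V) :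
    𝕋.T.obj (X × Y) → X × Y → V :=
  fun w p => a (tmap 𝕋.T Prod.fst w) p.1 * b (tmap 𝕋.T Prod.snd w) p.2

/-- The structure `hom_ξ` of the `𝕋`-category `V`. -/
def homRel : 𝕋.T.obj V → V → V := fun v' v => 𝕋.xi v' ⇨ₗ v

/-- The condition `a(x', x) ≤ b(T f x', f x)` on a function. -/
def IsFunctorial {X Y : Type u} (a : 𝕋.T.obj X → X → V) (b : 𝕋.T.obj Y → Y → V)
    (f : X → Y) : Prop :=
  ∀ x' x, a x' x ≤ b (tmap 𝕋.T f x') (f x)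

end TopTheory

/-- `𝕋`-categories. -/
structure TCat {V : Type u} [CommMonoid V] [CompleteLattice V] [IsQuantale V]
    (𝕋 : TopTheory V) where
  carrier : Type u
  str : 𝕋.T.obj carrier → carrier → V
  refl : ∀ x, 1 ≤ str (tunit 𝕋.T carrier x) x
  trans : ∀ xx x' x, 𝕋.relExt str xx x' * str x' x ≤ str (tmul 𝕋.T carrier xx) x

section TCats

variable {V : Type u} [CommMonoid V] [CompleteLattice V] [IsQuantale V] {𝕋 : TopTheory V}

/-- `𝕋`-functors. -/
structure TFunctor (X Y : TCat 𝕋) where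
  toFun : X.carrier → Y.carrier
  functorial : 𝕋.IsFunctorial X.str Y.str toFun

/-- The underlying `𝕋`-relations of arrows `X ⇀ Y`. -/
abbrev TRel (X Y : TCat 𝕋) : Type u := 𝕋.T.obj X.carrier → Y.carrier → V

/-- `φ : X ⇀ Y` is a `𝕋`-distributor. -/
def IsDist (X Y : TCat 𝕋) (φ : TRel X Y) : Prop :=
  𝕋.kcomp φ X.str ≤ φ ∧ 𝕋.kcomp Y.str φ ≤ φ

namespace TFunctor

/-- Identity functor. -/
def id (X : TCat 𝕋) : TFunctor X X where
  toFun x := x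
  functorial x' x := by rw [tmap_id]

/-- Composite functor `g · f`. -/
def comp {X Y Z : TCat 𝕋} (g : TFunctor Y Z) (f : TFunctor X Y) : TFunctor X Z where
  toFun x := g.toFun (f.toFun x)
  functorial x' x := by
    have h := (f.functorial x' x).trans (g.functorial _ _)
    rwa [tmap_tmap] at h

/-- `f_* = b · T f : X ⇀ Y`. -/
def lower {X Y : TCat 𝕋} (f : TFunctor X Y) : TRel X Y :=
  fun x' y => Y.str (tmap 𝕋.T f.toFun x') y

/-- `f^* = f° · b : Y ⇀ X`. -/
def upper {X Y : TCat 𝕋} (f : TFunctor X Y) : TRel Y X :=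
  fun y' x => Y.str y' (f.toFun x)

/-- `f ≤ g` in the 2-category of `𝕋`-categories: `f^* ≤ g^*`. -/
def Le {X Y : TCat 𝕋} (f g : TFunctor X Y) : Prop := f.upper ≤ g.upper

/-- `f ≅ g`. -/
def Equivalent {X Y : TCat 𝕋} (f g : TFunctor X Y) : Prop := f.Le g ∧ g.Le f

/-- `f ⊣ g`. -/
def Adjoint {X Y : TCat 𝕋} (f : TFunctor X Y) (g : TFunctor Y X) : Prop :=
  (TFunctor.id X).Le (g.comp f) ∧ (f.comp g).Le (TFunctor.id Y)

/-- `f` is a left adjoint `𝕋`-functor. -/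
def IsLeftAdjoint {X Y : TCat 𝕋} (f : TFunctor X Y) : Prop := ∃ g : TFunctor Y X, f.Adjoint g

end TFunctor

/-- For `φ : Y ⇀ Z` and `h : Y → X`, the functor `g : Z → X` is a `φ`-weighted colimit of `h`,
that is, `g_*` is the extension of `h_*` along `φ`. -/
def IsColimit {X Y Z : TCat 𝕋} (φ : TRel Y Z) (h : TFunctor Y X) (g : TFunctor Z X) : Prop :=
  g.lower = 𝕋.kextend h.lower φ

/-! ### Auxiliary facts -/

theorem iSup_prop_mul {P : Prop} (f : P → V) (v : V) : (⨆ h : P, f h) * v = ⨆ h : P, f h * v := by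
  by_cases h : P
  · simp only [h, iSup_pos]
  · simp only [h, iSup_false, Quantale.bot_mul]

theorem mul_iSup_prop {P : Prop} (f : P → V) (v : V) : (v * ⨆ h : P, f h) = ⨆ h : P, v * f h := by
  by_cases h : P
  · simp only [h, iSup_pos]
  · simp only [h, iSup_false, Quantale.mul_bot]

theorem xiMap_tmap {X Y : Type u} (f : X → Y) (φ : Y → V) (x : 𝕋.T.obj X) :
    𝕋.xiMap φ (tmap 𝕋.T f x) = 𝕋.xiMap (fun y => φ (f y)) x := by
  simp only [TopTheory.xiMap, tmap_tmap]

theorem xiMap_one {X : Type u} (x : 𝕋.T.obj X) : 𝕋.xiMap (fun _ => (1 : V)) x = 1 := by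
  have h := 𝕋.xi_one (tmap 𝕋.T (fun _ => PUnit.unit) x)
  rwa [tmap_tmap] at h

theorem xiMap_mul {X : Type u} (φ ψ : X → V) (x : 𝕋.T.obj X) :
    𝕋.xiMap (fun y => φ y * ψ y) x = 𝕋.xiMap φ x * 𝕋.xiMap ψ x := by
  have h := 𝕋.xi_tensor (tmap 𝕋.T (fun y => (φ y, ψ y)) x)
  simp only [tmap_tmap] at h
  exact h

theorem xiMap_xiMap {X : Type u} (φ : X → V) (x : 𝕋.T.obj (𝕋.T.obj X)) :
    𝕋.xiMap (𝕋.xiMap φ) x = 𝕋.xiMap φ (tmul 𝕋.T X x) := by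
  have h := 𝕋.xi_mul (tmap 𝕋.T (tmap 𝕋.T φ) x)
  rw [tmap_tmap, tmul_tmap_tmap] at h
  exact h

theorem xiMap_mono {X : Type u} {φ ψ : X → V} (h : ∀ x, φ x ≤ ψ x) (x : 𝕋.T.obj X) :
    𝕋.xiMap φ x ≤ 𝕋.xiMap ψ x := 𝕋.xi_mono φ ψ h x

theorem xiMap_tunit {X : Type u} (φ : X → V) (x : X) :
    𝕋.xiMap φ (tunit 𝕋.T X x) = φ x := by
  simp only [TopTheory.xiMap, tmap_tunit, 𝕋.xi_unit]

theorem le_relExt {X Y : Type u} (r : X → Y → V) (w : 𝕋.T.obj (X × Y)) :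
    𝕋.xiMap (fun p : X × Y => r p.1 p.2) w ≤
      𝕋.relExt r (tmap 𝕋.T Prod.fst w) (tmap 𝕋.T Prod.snd w) :=
  le_iSup₂_of_le w ⟨rfl, rfl⟩ le_rfl

/-- Lifting along `1 × f : A × X → A × Y`. -/
theorem exists_lift_snd {A X Y : Type u} (f : X → Y) (x : 𝕋.T.obj X) (q : 𝕋.T.obj (A × Y))
    (h : tmap 𝕋.T Prod.snd q = tmap 𝕋.T f x) :
    ∃ w : 𝕋.T.obj (A × X), tmap 𝕋.T (fun p : A × X => (p.1, f p.2)) w = q ∧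
      tmap 𝕋.T Prod.snd w = x := by
  refine (𝕋.map_pullback (fun p : A × X => (p.1, f p.2)) Prod.snd Prod.snd f
    ⟨fun _ => rfl, ?_⟩).2 q x h
  rintro ⟨a, y⟩ x hx
  refine ⟨(a, x), ⟨?_, rfl⟩, ?_⟩
  · simp only [← hx]
  · rintro ⟨a', x'⟩ ⟨h1, h2⟩
    simp only [Prod.mk.injEq] at h1 h2 ⊢
    exact ⟨h1.1, h2⟩

/-- Lifting along `f × 1 : X × B → Y × B`. -/
theorem exists_lift_fst {B X Y : Type u} (f : X → Y) (x : 𝕋.T.obj X) (q : 𝕋.T.obj (Y × B))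
    (h : tmap 𝕋.T Prod.fst q = tmap 𝕋.T f x) :
    ∃ w : 𝕋.T.obj (X × B), tmap 𝕋.T (fun p : X × B => (f p.1, p.2)) w = q ∧
      tmap 𝕋.T Prod.fst w = x := by
  refine (𝕋.map_pullback (fun p : X × B => (f p.1, p.2)) Prod.fst Prod.fst f
    ⟨fun _ => rfl, ?_⟩).2 q x h
  rintro ⟨y, b⟩ x hx
  refine ⟨(x, b), ⟨?_, rfl⟩, ?_⟩
  · simp only [← hx]
  · rintro ⟨x', b'⟩ ⟨h1, h2⟩
    simp only [Prod.mk.injEq] at h1 h2 ⊢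
    exact ⟨h2, h1.2⟩

/-! ### Basic `𝕋`-categories -/

variable (𝕋) in
/-- The `𝕋`-category `G = (1, e_1°)`. -/
abbrev oneCat : TCat 𝕋 where
  carrier := PUnit
  str := 𝕋.unitRel PUnit
  refl x := le_iSup_of_le rfl le_rfl
  trans xx x' x := by
    by_cases hx : tunit 𝕋.T PUnit x = x'
    swap
    · simp [TopTheory.unitRel, hx]
    have h1 : 𝕋.unitRel PUnit x' x = 1 := by simp [TopTheory.unitRel, hx]
    rw [h1, mul_one]
    refine iSup₂_le ?_
    rintro w ⟨rfl, hw⟩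
    have h2 : (fun p : 𝕋.T.obj PUnit.{u + 1} × PUnit.{u + 1} => 𝕋.unitRel PUnit p.1 p.2) ≤
        powMap (fun y : PUnit.{u + 1} => (tunit 𝕋.T PUnit y, y)) (fun _ => (1 : V)) := by
      rintro ⟨t, y⟩
      refine iSup_le fun ht => ?_
      exact le_iSup₂_of_le y (Prod.ext ht rfl) le_rfl
    refine (𝕋.xi_mono _ _ h2 w).trans ?_
    rw [𝕋.xi_nat]
    refine iSup₂_le ?_
    rintro v rfl
    refine (𝕋.xi_one v).le.trans ?_
    rw [tmap_tmap] at hw ⊢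
    rw [tmap_id] at hw
    refine le_iSup_of_le ?_ le_rfl
    rw [hx, ← hw]
    exact (tmul_tmap_tunit v).symm

/-- The initial structure on a set with respect to a function into a `𝕋`-category. -/
abbrev TCat.induced (Y : TCat 𝕋) (S : Type u) (i : S → Y.carrier) : TCat 𝕋 where
  carrier := S
  str p s := Y.str (tmap 𝕋.T i p) (i s)
  refl s := by
    rw [tmap_tunit]
    exact Y.refl _
  trans xx x' x := by
    rw [← tmul_tmap_tmap]
    refine le_trans (mul_le_mul_left ?_ _) (Y.trans _ (tmap 𝕋.T i x') _)
    refine iSup₂_le ?_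
    rintro w ⟨rfl, rfl⟩
    have h := le_relExt (𝕋 := 𝕋) Y.str
      (tmap 𝕋.T (fun p : 𝕋.T.obj S × S => (tmap 𝕋.T i p.1, i p.2)) w)
    rw [xiMap_tmap, tmap_tmap, tmap_tmap] at h
    rw [tmap_tmap, tmap_tmap]
    exact h

variable (𝕋) in
/-- Points of `V^{|X|}`: functions `ψ : T X → V` that are `𝕋`-functors `|X| ⊗ G → V`. -/
def IsPowPoint (X : Type u) (ψ : 𝕋.T.obj X → V) : Prop :=
  𝕋.IsFunctorial (𝕋.tensorRel (𝕋.freeRel X) (𝕋.unitRel PUnit.{u + 1})) 𝕋.homRel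
    (fun p : 𝕋.T.obj X × PUnit.{u + 1} => ψ p.1)

theorem isPowPoint_iff (X : Type u) (ψ : 𝕋.T.obj X → V) :
    IsPowPoint 𝕋 X ψ ↔ ∀ w : 𝕋.T.obj (𝕋.T.obj X × PUnit.{u + 1}),
      tmap 𝕋.T Prod.snd w = tunit 𝕋.T PUnit.{u + 1} PUnit.unit →
      𝕋.xiMap (fun p : 𝕋.T.obj X × PUnit.{u + 1} => ψ p.1) w ≤
        ψ (tmul 𝕋.T X (tmap 𝕋.T Prod.fst w)) := by
  constructor
  · intro h w hw
    have h1 := h w (tmul 𝕋.T X (tmap 𝕋.T Prod.fst w), PUnit.unit)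
    simp only [TopTheory.tensorRel, TopTheory.freeRel, TopTheory.unitRel, hw,
      TopTheory.homRel, iSup_pos, mul_one] at h1
    rw [Quantale.leftMulResiduation_le_iff_mul_le, one_mul] at h1
    exact h1
  · rintro h w ⟨x, ⟨⟩⟩
    by_cases h1 : tmul 𝕋.T X (tmap 𝕋.T Prod.fst w) = x
    swap
    · simp [TopTheory.tensorRel, TopTheory.freeRel, h1]
    by_cases h2 : tunit 𝕋.T PUnit.{u + 1} PUnit.unit = tmap 𝕋.T Prod.snd w
    swap
    · simp [TopTheory.tensorRel, TopTheory.unitRel, h2]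
    subst h1
    simp only [TopTheory.tensorRel, TopTheory.freeRel, TopTheory.unitRel, h2,
      TopTheory.homRel, iSup_pos, mul_one]
    rw [Quantale.leftMulResiduation_le_iff_mul_le, one_mul]
    exact h w h2.symm

variable (𝕋) in
/-- The function space `V^{|X|}`, with structure
`⟦p, ψ⟧ = ⋀ {hom (ξ (T ev q), ψ (m_X (T π₁ q))) ∣ q ∈ T (|X| × V^{|X|}), T π₂ q = p}`. -/
abbrev powCat (X : Type u) : TCat 𝕋 where
  carrier := {ψ : 𝕋.T.obj X → V // IsPowPoint 𝕋 X ψ}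
  str p ψ := ⨅ (q : 𝕋.T.obj (𝕋.T.obj X × {ψ : 𝕋.T.obj X → V // IsPowPoint 𝕋 X ψ}))
    (_ : tmap 𝕋.T Prod.snd q = p),
      𝕋.xiMap (fun r => r.2.1 r.1) q ⇨ₗ ψ.1 (tmul 𝕋.T X (tmap 𝕋.T Prod.fst q))
  refl ψ := by
    refine le_iInf₂ fun q hq => ?_
    rw [Quantale.leftMulResiduation_le_iff_mul_le, one_mul]
    obtain ⟨w, rfl, hw⟩ := exists_lift_snd (𝕋 := 𝕋) (fun _ : PUnit.{u + 1} => ψ)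
      (tunit 𝕋.T _ PUnit.unit) q (by rw [hq, tmap_tunit])
    have h := (isPowPoint_iff X ψ.1).1 ψ.2 w hw
    rw [xiMap_tmap, tmap_tmap]
    exact h
  trans pp p ψ := by
    refine le_iInf₂ fun q hq => ?_
    rw [Quantale.leftMulResiduation_le_iff_mul_le]
    rw [mul_assoc, TopTheory.relExt, Quantale.iSup_mul_distrib]
    refine iSup_le fun W => ?_
    rw [iSup_prop_mul]
    refine iSup_le ?_
    rintro ⟨hW1, hW2⟩
    obtain ⟨Q, hQ1, rfl⟩ := (𝕋.mul_pullback
      (Prod.snd : 𝕋.T.obj X × {ψ : 𝕋.T.obj X → V // IsPowPoint 𝕋 X ψ} → _)).2 pp q hq.symm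
    obtain ⟨R, rfl, hR⟩ := exists_lift_fst (𝕋 := 𝕋) (tmap 𝕋.T
      (Prod.snd : 𝕋.T.obj X × {ψ : 𝕋.T.obj X → V // IsPowPoint 𝕋 X ψ} → _)) Q W
      (by rw [hW1, hQ1])
    rw [tmap_tmap] at hW2
    set H : 𝕋.T.obj (𝕋.T.obj X × {ψ : 𝕋.T.obj X → V // IsPowPoint 𝕋 X ψ}) ×
        {ψ : 𝕋.T.obj X → V // IsPowPoint 𝕋 X ψ} →
        𝕋.T.obj X × {ψ : 𝕋.T.obj X → V // IsPowPoint 𝕋 X ψ} :=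
      fun r => (tmul 𝕋.T X (tmap 𝕋.T Prod.fst r.1), r.2) with hH
    have h2 : tmap 𝕋.T Prod.snd (tmap 𝕋.T H R) = p := by
      rw [tmap_tmap]
      exact hW2
    have h3 : tmul 𝕋.T X (tmap 𝕋.T Prod.fst (tmap 𝕋.T H R)) =
        tmul 𝕋.T X (tmap 𝕋.T Prod.fst (tmul 𝕋.T _ Q)) := by
      rw [tmap_tmap, ← tmul_tmap_tmap, ← hR, tmap_tmap, ← tmul_tmap_tmul, tmap_tmap]
    rw [mul_left_comm]
    have h4 : (⨅ (q : 𝕋.T.obj (𝕋.T.obj X × {ψ : 𝕋.T.obj X → V // IsPowPoint 𝕋 X ψ}))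
        (_ : tmap 𝕋.T Prod.snd q = p),
          𝕋.xiMap (fun r => r.2.1 r.1) q ⇨ₗ ψ.1 (tmul 𝕋.T X (tmap 𝕋.T Prod.fst q))) ≤
        𝕋.xiMap (fun r => r.2.1 r.1) (tmap 𝕋.T H R) ⇨ₗ
          ψ.1 (tmul 𝕋.T X (tmap 𝕋.T Prod.fst (tmul 𝕋.T _ Q))) := by
      refine iInf₂_le_of_le (tmap 𝕋.T H R) h2 ?_
      rw [h3]
    refine le_trans (mul_le_mul' h4 ?_)
      (Quantale.leftMulResiduation_le_iff_mul_le.1 le_rfl)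
    rw [← xiMap_xiMap, ← hR, xiMap_tmap, xiMap_tmap, xiMap_tmap, ← xiMap_mul]
    refine xiMap_mono ?_ R
    rintro ⟨q', ψ'⟩
    rw [← Quantale.leftMulResiduation_le_iff_mul_le]
    exact iInf₂_le_of_le q' rfl le_rfl

/-- A presheaf `ψ : X ⇀ G` as a `𝕋`-relation. -/
def presheafRel (X : TCat 𝕋) (ψ : 𝕋.T.obj X.carrier → V) : TRel X (oneCat 𝕋) := fun x _ => ψ x

theorem isPowPoint_of_isDist (X : TCat 𝕋) (ψ : 𝕋.T.obj X.carrier → V)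
    (h : IsDist X (oneCat 𝕋) (presheafRel X ψ)) : IsPowPoint 𝕋 X.carrier ψ := by
  rw [isPowPoint_iff]
  intro w hw
  refine le_trans ?_ (h.2 (tmul 𝕋.T _ (tmap 𝕋.T Prod.fst w)) PUnit.unit)
  refine le_iSup_of_le (tunit 𝕋.T PUnit PUnit.unit) ?_
  have h1 : (oneCat 𝕋).str (tunit 𝕋.T PUnit PUnit.unit) PUnit.unit = 1 := by
    simp [TopTheory.unitRel]
  rw [h1, mul_one]
  refine le_iSup₂_of_le (tmap 𝕋.T Prod.fst w) rfl ?_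
  rw [← hw]
  exact le_relExt (presheafRel X ψ) w

/-- The `𝕋`-category `P X` of presheaves, a subcategory of `V^{|X|}`. -/
abbrev Psh (X : TCat 𝕋) : TCat 𝕋 :=
  (powCat 𝕋 X.carrier).induced
    {ψ : 𝕋.T.obj X.carrier → V // IsDist X (oneCat 𝕋) (presheafRel X ψ)}
    (fun ψ => ⟨ψ.1, isPowPoint_of_isDist X ψ.1 ψ.2⟩)

/-- The structure of `P X` can be computed with `q ∈ T (|X| × S)`, for any set `S` of presheaves. -/
theorem le_psh_str_iff (X : TCat 𝕋) {S : Type u} (i : S → (Psh X).carrier) (p : 𝕋.T.obj S)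
    (ψ : (Psh X).carrier) (v : V) :
    v ≤ (Psh X).str (tmap 𝕋.T i p) ψ ↔
      ∀ q : 𝕋.T.obj (𝕋.T.obj X.carrier × S), tmap 𝕋.T Prod.snd q = p →
        v * 𝕋.xiMap (fun r => (i r.2).1 r.1) q ≤
          ψ.1 (tmul 𝕋.T X.carrier (tmap 𝕋.T Prod.fst q)) := by
  simp only [Psh, TCat.induced, powCat, le_iInf_iff,
    Quantale.leftMulResiduation_le_iff_mul_le]
  constructor
  · intro h q hq
    have h1 := h (tmap 𝕋.T (fun r => (r.1, ⟨(i r.2).1, isPowPoint_of_isDist X _ (i r.2).2⟩)) q)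
      (by rw [tmap_tmap, tmap_tmap, ← hq, tmap_tmap])
    rw [xiMap_tmap, tmap_tmap] at h1
    exact h1
  · intro h q hq
    rw [tmap_tmap] at hq
    obtain ⟨w, rfl, hw⟩ := exists_lift_snd (𝕋 := 𝕋) _ p q hq
    rw [xiMap_tmap, tmap_tmap]
    exact h w hw

/-- The functor `G → X` picking the point `x`. -/
def pointFunctor (X : TCat 𝕋) (x : X.carrier) : TFunctor (oneCat 𝕋) X where
  toFun _ := x
  functorial t y := by
    refine iSup_le fun h => ?_
    rw [← h, tmap_tunit]
    exact X.refl x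

end TCats

/-- A class `Φ` of `𝕋`-distributors satisfying the three closure axioms. -/
structure DistClass {V : Type u} [CommMonoid V] [CompleteLattice V] [IsQuantale V]
    (𝕋 : TopTheory V) where
  /-- `φ : X ⇀ Y` belongs to the class -/
  mem : ∀ X Y : TCat 𝕋, TRel X Y → Prop
  isDist : ∀ {X Y : TCat 𝕋} {φ : TRel X Y}, mem X Y φ → IsDist X Y φ
  upper_mem : ∀ {X Y : TCat 𝕋} (f : TFunctor X Y), mem Y X f.upper
  upper_comp : ∀ {X Y A : TCat 𝕋} {φ : TRel X Y} (f : TFunctor A Y), mem X Y φ →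
    mem X A (𝕋.kcomp f.upper φ)
  comp_upper : ∀ {X Y B : TCat 𝕋} {φ : TRel X Y} (f : TFunctor X B), mem X Y φ →
    mem B Y (𝕋.kcomp φ f.upper)
  comp_lower : ∀ {X Y A : TCat 𝕋} {φ : TRel X Y} (f : TFunctor A X), mem X Y φ →
    mem A X f.lower → mem A Y (𝕋.kcomp φ f.lower)
  pointwise : ∀ {X Y : TCat 𝕋} {φ : TRel X Y}, IsDist X Y φ →
    (∀ y, mem X (oneCat 𝕋) (𝕋.kcomp (pointFunctor Y y).upper φ)) → mem X Y φ

section Relative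

variable {V : Type u} [CommMonoid V] [CompleteLattice V] [IsQuantale V] {𝕋 : TopTheory V}

namespace DistClass

variable (Φ : DistClass 𝕋)

/-- `f` is `Φ`-dense: `f_* ∈ Φ`. -/
def Dense {X Y : TCat 𝕋} (f : TFunctor X Y) : Prop := Φ.mem X Y f.lower

/-- `X` is `Φ`-cocomplete: all colimits in `X` weighted by members of `Φ` exist. -/
def Cocomplete (X : TCat 𝕋) : Prop :=
  ∀ (Y Z : TCat 𝕋) (φ : TRel Y Z) (h : TFunctor Y X), Φ.mem Y Z φ →
    ∃ g : TFunctor Z X, IsColimit φ h g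

/-- `f` is `Φ`-cocontinuous: it preserves all existing colimits weighted by members of `Φ`. -/
def Cocontinuous {X Y : TCat 𝕋} (f : TFunctor X Y) : Prop :=
  ∀ (A B : TCat 𝕋) (φ : TRel A B) (h : TFunctor A X) (g : TFunctor B X), Φ.mem A B φ →
    IsColimit φ h g → IsColimit φ (f.comp h) (f.comp g)

/-- `Φ X`, the subcategory of `P X` of all presheaves that belong to `Φ`. -/
abbrev phiPsh (X : TCat 𝕋) : TCat 𝕋 :=
  (Psh X).induced {ψ : (Psh X).carrier // Φ.mem X (oneCat 𝕋) (presheafRel X ψ.1)} Subtype.val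

theorem le_phiPsh_str_iff (X : TCat 𝕋) {S : Type u} (i : S → (Φ.phiPsh X).carrier)
    (p : 𝕋.T.obj S) (ψ : (Φ.phiPsh X).carrier) (v : V) :
    v ≤ (Φ.phiPsh X).str (tmap 𝕋.T i p) ψ ↔
      ∀ q : 𝕋.T.obj (𝕋.T.obj X.carrier × S), tmap 𝕋.T Prod.snd q = p →
        v * 𝕋.xiMap (fun r => (i r.2).1.1 r.1) q ≤
          ψ.1.1 (tmul 𝕋.T X.carrier (tmap 𝕋.T Prod.fst q)) := by
  rw [← le_psh_str_iff X (fun s => (i s).1) p ψ.1 v]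
  exact Eq.to_iff (congrArg (fun t => v ≤ (Psh X).str t ψ.1) (tmap_tmap _ _ _))

/-- The Yoneda functor `X → Φ X`, `x ↦ a(-, x)`. -/
def yoneda (X : TCat 𝕋) : TFunctor X (Φ.phiPsh X) where
  toFun x := ⟨⟨fun x' => X.str x' x, Φ.isDist (Φ.upper_mem (pointFunctor X x))⟩,
    Φ.upper_mem (pointFunctor X x)⟩
  functorial x' x := by
    refine (le_phiPsh_str_iff Φ X _ _ _ _).2 ?_
    rintro q rfl
    refine le_trans ?_ (X.trans (tmap 𝕋.T Prod.fst q) (tmap 𝕋.T Prod.snd q) x)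
    rw [mul_comm]
    exact mul_le_mul_left (le_relExt X.str q) _

theorem kcomp_upper_eq {X Y : TCat 𝕋} (f : TFunctor X Y) (χ : 𝕋.T.obj X.carrier → V) :
    (fun y => 𝕋.kcomp (presheafRel X χ) f.upper y PUnit.unit) =
      powMap (fun W : 𝕋.T.obj (𝕋.T.obj Y.carrier × X.carrier) =>
          tmul 𝕋.T Y.carrier (tmap 𝕋.T Prod.fst W))
        (fun W => 𝕋.xiMap (fun p : 𝕋.T.obj Y.carrier × X.carrier => f.upper p.1 p.2) W *
          χ (tmap 𝕋.T Prod.snd W)) := by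
  funext y
  simp only [TopTheory.kcomp, TopTheory.klExt, TopTheory.relExt, powMap,
    Quantale.iSup_mul_distrib, iSup_prop_mul]
  apply le_antisymm
  · refine iSup_le fun x => iSup₂_le fun yy hyy => iSup₂_le ?_
    rintro W ⟨rfl, rfl⟩
    exact le_iSup₂_of_le W hyy le_rfl
  · refine iSup₂_le fun W hW => ?_
    exact le_iSup_of_le (tmap 𝕋.T Prod.snd W) <| le_iSup₂_of_le (tmap 𝕋.T Prod.fst W) hW <|
      le_iSup₂_of_le W ⟨rfl, rfl⟩ le_rfl

/-- The functor `Φ f : Φ X → Φ Y`, `ψ ↦ ψ ∘ f^*`. -/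
def phiMap {X Y : TCat 𝕋} (f : TFunctor X Y) : TFunctor (Φ.phiPsh X) (Φ.phiPsh Y) where
  toFun ψ := ⟨⟨fun y => 𝕋.kcomp (presheafRel X ψ.1.1) f.upper y PUnit.unit,
    Φ.isDist (Φ.comp_upper f ψ.2)⟩, Φ.comp_upper f ψ.2⟩
  functorial p ψ := by
    refine (le_phiPsh_str_iff Φ Y _ _ _ _).2 ?_
    rintro w rfl
    have h1 : (fun r : 𝕋.T.obj Y.carrier × (Φ.phiPsh X).carrier =>
        𝕋.kcomp (presheafRel X r.2.1.1) f.upper r.1 PUnit.unit) =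
        powMap (fun E : 𝕋.T.obj (𝕋.T.obj Y.carrier × X.carrier) × (Φ.phiPsh X).carrier =>
          (tmul 𝕋.T Y.carrier (tmap 𝕋.T Prod.fst E.1), E.2))
        (fun E => 𝕋.xiMap (fun p : 𝕋.T.obj Y.carrier × X.carrier => f.upper p.1 p.2) E.1 *
          E.2.1.1 (tmap 𝕋.T Prod.snd E.1)) := by
      funext ⟨y, χ⟩
      rw [show 𝕋.kcomp (presheafRel X χ.1.1) f.upper y PUnit.unit = _ from
        congrFun (kcomp_upper_eq f χ.1.1) y]
      simp only [powMap]
      apply le_antisymm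
      · refine iSup₂_le fun W hW => ?_
        exact le_iSup₂_of_le (W, χ) (by rw [hW]) le_rfl
      · refine iSup₂_le ?_
        rintro ⟨W, χ'⟩ h
        simp only [Prod.mk.injEq] at h
        obtain ⟨h1, rfl⟩ := h
        exact le_iSup₂_of_le W h1 le_rfl
    have h2 := 𝕋.xi_nat
      (fun E : 𝕋.T.obj (𝕋.T.obj Y.carrier × X.carrier) × (Φ.phiPsh X).carrier =>
        (tmul 𝕋.T Y.carrier (tmap 𝕋.T Prod.fst E.1), E.2))
      (fun E => 𝕋.xiMap (fun p : 𝕋.T.obj Y.carrier × X.carrier => f.upper p.1 p.2) E.1 *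
        E.2.1.1 (tmap 𝕋.T Prod.snd E.1)) w
    rw [← h1] at h2
    refine (mul_le_mul_right h2.le _).trans ?_
    rw [powMap, Quantale.mul_iSup_distrib]
    refine iSup_le fun v => ?_
    rw [mul_iSup_prop]
    refine iSup_le ?_
    rintro rfl
    have h3 : (Φ.phiPsh X).str (tmap 𝕋.T Prod.snd v) ψ *
        𝕋.xiMap (fun E : 𝕋.T.obj (𝕋.T.obj Y.carrier × X.carrier) × (Φ.phiPsh X).carrier =>
          E.2.1.1 (tmap 𝕋.T Prod.snd E.1)) v ≤
        ψ.1.1 (tmap 𝕋.T Prod.snd (tmul 𝕋.T _ (tmap 𝕋.T Prod.fst v))) := by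
      have h4 := (le_phiPsh_str_iff Φ X (fun s => s) (tmap 𝕋.T Prod.snd v) ψ _).1
        (by rw [tmap_id])
        (tmap 𝕋.T (fun E => (tmap 𝕋.T Prod.snd E.1, E.2)) v) (by rw [tmap_tmap])
      rw [xiMap_tmap, tmap_tmap] at h4
      refine h4.trans_eq ?_
      rw [← tmul_tmap_tmap, tmap_tmap]
    have h5 : 𝕋.xi (tmap 𝕋.T (fun E : 𝕋.T.obj (𝕋.T.obj Y.carrier × X.carrier) ×
          (Φ.phiPsh X).carrier =>
        𝕋.xiMap (fun p : 𝕋.T.obj Y.carrier × X.carrier => f.upper p.1 p.2) E.1 *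
          E.2.1.1 (tmap 𝕋.T Prod.snd E.1)) v) =
        𝕋.xiMap (fun p : 𝕋.T.obj Y.carrier × X.carrier => f.upper p.1 p.2)
          (tmul 𝕋.T _ (tmap 𝕋.T Prod.fst v)) *
        𝕋.xiMap (fun E : 𝕋.T.obj (𝕋.T.obj Y.carrier × X.carrier) × (Φ.phiPsh X).carrier =>
          E.2.1.1 (tmap 𝕋.T Prod.snd E.1)) v := by
      rw [← xiMap_xiMap, xiMap_tmap]
      exact xiMap_mul _ _ v
    rw [h5, mul_left_comm, tmap_tmap]
    refine (mul_le_mul_right h3 _).trans ?_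
    refine le_trans ?_ (congrFun (kcomp_upper_eq f ψ.1.1) _).ge
    refine le_iSup₂_of_le (tmul 𝕋.T _ (tmap 𝕋.T Prod.fst v)) ?_ le_rfl
    beta_reduce
    rw [← tmul_tmap_tmap, ← tmul_tmap_tmul]
    simp only [tmap_tmap]

/-- `S` is a supremum functor of `X`: a left adjoint `Φ X → X` of the Yoneda functor. -/
def IsSup (X : TCat 𝕋) (S : TFunctor (Φ.phiPsh X) X) : Prop := S.Adjoint (Φ.yoneda X)

end DistClass

end Relative

/-! ### Kleisli convolution as composition of relations -/

section KleisliConvolution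

variable {V : Type u} [CommMonoid V] [CompleteLattice V] [IsQuantale V] {𝕋 : TopTheory V}
variable {X Y Z W : Type u}

theorem klExt_le_iff {α : 𝕋.T.obj X → Y → V} {x : 𝕋.T.obj X} {y : 𝕋.T.obj Y} {v : V} :
    𝕋.klExt α x y ≤ v ↔ ∀ w : 𝕋.T.obj (𝕋.T.obj X × Y), tmul 𝕋.T X (tmap 𝕋.T Prod.fst w) = x →
      tmap 𝕋.T Prod.snd w = y → 𝕋.xiMap (fun p : 𝕋.T.obj X × Y => α p.1 p.2) w ≤ v := by
  simp only [TopTheory.klExt, TopTheory.relExt, iSup_le_iff]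
  constructor
  · intro h w h1 h2
    exact h _ h1 w ⟨rfl, h2⟩
  · rintro h xx hxx w ⟨rfl, h2⟩
    exact h w hxx h2

theorem le_klExt (α : 𝕋.T.obj X → Y → V) (w : 𝕋.T.obj (𝕋.T.obj X × Y)) :
    𝕋.xiMap (fun p : 𝕋.T.obj X × Y => α p.1 p.2) w ≤
      𝕋.klExt α (tmul 𝕋.T X (tmap 𝕋.T Prod.fst w)) (tmap 𝕋.T Prod.snd w) :=
  klExt_le_iff.1 le_rfl w rfl rfl

theorem klExt_mono {α α' : 𝕋.T.obj X → Y → V} (h : α ≤ α') (x : 𝕋.T.obj X) (y : 𝕋.T.obj Y) :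
    𝕋.klExt α x y ≤ 𝕋.klExt α' x y := by
  refine klExt_le_iff.2 ?_
  rintro w rfl rfl
  exact (xiMap_mono (fun p => h p.1 p.2) w).trans (le_klExt α' w)

theorem kcomp_le_iff {β : 𝕋.T.obj Y → Z → V} {α : 𝕋.T.obj X → Y → V} {x : 𝕋.T.obj X} {z : Z}
    {v : V} : 𝕋.kcomp β α x z ≤ v ↔ ∀ y, 𝕋.klExt α x y * β y z ≤ v :=
  iSup_le_iff

theorem klExt_mul_le_kcomp (β : 𝕋.T.obj Y → Z → V) (α : 𝕋.T.obj X → Y → V) (x : 𝕋.T.obj X)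
    (y : 𝕋.T.obj Y) (z : Z) : 𝕋.klExt α x y * β y z ≤ 𝕋.kcomp β α x z :=
  kcomp_le_iff.1 le_rfl y

theorem kcomp_mono {β β' : 𝕋.T.obj Y → Z → V} {α α' : 𝕋.T.obj X → Y → V} (hβ : β ≤ β')
    (hα : α ≤ α') : 𝕋.kcomp β α ≤ 𝕋.kcomp β' α' := fun x z =>
  kcomp_le_iff.2 fun y => (mul_le_mul' (klExt_mono hα x y) (hβ y z)).trans
    (klExt_mul_le_kcomp β' α' x y z)

/-- Writing the convolution as a direct image under $P$ makes the naturality axiom `xi_nat`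
applicable to it. -/
theorem kcomp_eq_powMap (β : 𝕋.T.obj Y → Z → V) (α : 𝕋.T.obj X → Y → V) :
    (fun p : 𝕋.T.obj X × Z => 𝕋.kcomp β α p.1 p.2) =
      powMap (fun E : 𝕋.T.obj (𝕋.T.obj X × Y) × Z =>
          (tmul 𝕋.T X (tmap 𝕋.T Prod.fst E.1), E.2))
        (fun E => 𝕋.xiMap (fun p : 𝕋.T.obj X × Y => α p.1 p.2) E.1 *
          β (tmap 𝕋.T Prod.snd E.1) E.2) := by
  funext ⟨x, z⟩
  apply le_antisymm
  · refine kcomp_le_iff.2 fun y => ?_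
    rw [← Quantale.leftMulResiduation_le_iff_mul_le, klExt_le_iff]
    rintro w rfl rfl
    rw [Quantale.leftMulResiduation_le_iff_mul_le]
    exact le_iSup₂_of_le (w, z) rfl le_rfl
  · refine iSup₂_le ?_
    rintro ⟨w, z'⟩ h
    simp only [Prod.mk.injEq] at h
    obtain ⟨rfl, rfl⟩ := h
    exact (mul_le_mul_left (le_klExt α w) _).trans (klExt_mul_le_kcomp β α _ _ _)

/-- `α ↦ T_ξ α · m°` sends Kleisli convolution to composition of `V`-relations. -/
theorem klExt_kcomp (β : 𝕋.T.obj Y → Z → V) (α : 𝕋.T.obj X → Y → V) (x : 𝕋.T.obj X)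
    (z : 𝕋.T.obj Z) :
    𝕋.klExt (𝕋.kcomp β α) x z = ⨆ y, 𝕋.klExt α x y * 𝕋.klExt β y z := by
  -- Compatibility of $\xi$ with $\otimes$ splits the product, and $\xi\cdot T\xi=\xi\cdot m$
  -- flattens the nested factor.
  have key : ∀ v : 𝕋.T.obj (𝕋.T.obj (𝕋.T.obj X × Y) × Z),
      𝕋.xi (tmap 𝕋.T (fun E : 𝕋.T.obj (𝕋.T.obj X × Y) × Z =>
        𝕋.xiMap (fun p : 𝕋.T.obj X × Y => α p.1 p.2) E.1 * β (tmap 𝕋.T Prod.snd E.1) E.2) v) =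
      𝕋.xiMap (fun p : 𝕋.T.obj X × Y => α p.1 p.2) (tmul 𝕋.T _ (tmap 𝕋.T Prod.fst v)) *
      𝕋.xiMap (fun p : 𝕋.T.obj Y × Z => β p.1 p.2)
        (tmap 𝕋.T (fun E => (tmap 𝕋.T Prod.snd E.1, E.2)) v) := by
    intro v
    rw [← xiMap_xiMap, xiMap_tmap, xiMap_tmap]
    exact xiMap_mul _ _ v
  apply le_antisymm
  · refine klExt_le_iff.2 ?_
    rintro w rfl rfl
    rw [kcomp_eq_powMap, TopTheory.xiMap, 𝕋.xi_nat]
    refine iSup₂_le ?_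
    rintro v rfl
    refine (key v).le.trans ?_
    refine le_iSup_of_le (tmap 𝕋.T Prod.snd (tmul 𝕋.T _ (tmap 𝕋.T Prod.fst v)))
      (mul_le_mul' (klExt_le_iff.1 le_rfl _ ?_ rfl) (klExt_le_iff.1 le_rfl _ ?_ ?_))
    · rw [← tmul_tmap_tmap, ← tmul_tmap_tmul]
      simp only [tmap_tmap]
    · rw [← tmul_tmap_tmap]
      simp only [tmap_tmap]
    · simp only [tmap_tmap]
  · refine iSup_le fun y => ?_
    -- The two joins are removed one at a time, by residuating against the other factor.
    rw [← Quantale.leftMulResiduation_le_iff_mul_le, klExt_le_iff]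
    rintro U rfl rfl
    rw [Quantale.leftMulResiduation_le_iff_mul_le, mul_comm,
      ← Quantale.leftMulResiduation_le_iff_mul_le, klExt_le_iff]
    rintro R hR rfl
    rw [Quantale.leftMulResiduation_le_iff_mul_le, mul_comm]
    -- `U` is lifted along $m$ to a `Q` lying over the same element of $TTY$ as `R`; the next lift
    -- glues `Q` and `R` to a single `v`.
    obtain ⟨Q, hQ, rfl⟩ := (𝕋.mul_pullback (Prod.snd : 𝕋.T.obj X × Y → Y)).2 _ U hR
    obtain ⟨v, rfl, rfl⟩ := exists_lift_fst (𝕋 := 𝕋) (tmap 𝕋.T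
      (Prod.snd : 𝕋.T.obj X × Y → Y)) Q R hQ.symm
    rw [← key]
    refine le_trans ?_ (klExt_le_iff.1 le_rfl (tmap 𝕋.T
      (fun E => (tmul 𝕋.T X (tmap 𝕋.T Prod.fst E.1), E.2)) v) ?_ ?_)
    · rw [kcomp_eq_powMap, TopTheory.xiMap, 𝕋.xi_nat]
      exact le_iSup₂_of_le v rfl le_rfl
    · rw [← tmul_tmap_tmap, ← tmul_tmap_tmul]
      simp only [tmap_tmap]
    · simp only [tmap_tmap]

theorem kcomp_assoc (γ : 𝕋.T.obj Z → W → V) (β : 𝕋.T.obj Y → Z → V) (α : 𝕋.T.obj X → Y → V) :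
    𝕋.kcomp γ (𝕋.kcomp β α) = 𝕋.kcomp (𝕋.kcomp γ β) α := by
  funext x w
  rw [TopTheory.kcomp, TopTheory.kcomp]
  simp only [klExt_kcomp, TopTheory.kcomp, Quantale.iSup_mul_distrib, Quantale.mul_iSup_distrib]
  rw [iSup_comm]
  simp only [mul_assoc]

/-- The extension along `α` is right adjoint to composition with `α`. -/
theorem le_kextend_iff {δ : 𝕋.T.obj Y → Z → V} {γ : 𝕋.T.obj X → Z → V}
    {α : 𝕋.T.obj X → Y → V} : δ ≤ 𝕋.kextend γ α ↔ 𝕋.kcomp δ α ≤ γ := by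
  simp only [Pi.le_def, TopTheory.kextend, le_iInf_iff, kcomp_le_iff,
    Quantale.leftMulResiduation_le_iff_mul_le]
  refine ⟨fun h x z y => ?_, fun h y z x => ?_⟩
  · rw [mul_comm]
    exact h y z x
  · rw [mul_comm]
    exact h x z y

theorem one_le_klExt_self {a : 𝕋.T.obj X → X → V} (h : ∀ x, 1 ≤ a (tunit 𝕋.T X x) x)
    (x : 𝕋.T.obj X) : 1 ≤ 𝕋.klExt a x x := by
  have h1 := klExt_le_iff.1 (le_refl (𝕋.klExt a x x))
    -- The witness is $T\langle e_X,1_X\rangle(\mathfrak x)$; on it the value is at least $\xi\cdot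
    -- T(k)=k$.
    (tmap 𝕋.T (fun y => (tunit 𝕋.T X y, y)) x)
    (by rw [tmap_tmap]; exact tmul_tmap_tunit x) (by rw [tmap_tmap]; exact tmap_id x)
  rw [xiMap_tmap] at h1
  refine le_trans ?_ h1
  rw [← xiMap_one (𝕋 := 𝕋) x]
  exact xiMap_mono h x

theorem le_klExt_tunit (α : 𝕋.T.obj X → Y → V) (x : 𝕋.T.obj X) (y : Y) :
    α x y ≤ 𝕋.klExt α x (tunit 𝕋.T Y y) := by
  have h := klExt_le_iff.1 (le_refl (𝕋.klExt α x (tunit 𝕋.T Y y)))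
    (tunit 𝕋.T _ (x, y)) (by rw [tmap_tunit, tmul_tunit]) (by rw [tmap_tunit])
  rwa [xiMap_tunit] at h

/-- Pushing witnesses forward along $Tf\times1$ gives $\le$. For $\ge$, a witness is lifted back,
using that the naturality square of $m$ at $f$ is a weak pullback. -/
theorem klExt_tmap (f : X → Y) (β : 𝕋.T.obj Y → Z → V) (x : 𝕋.T.obj X) (z : 𝕋.T.obj Z) :
    𝕋.klExt (fun x' z' => β (tmap 𝕋.T f x') z') x z = 𝕋.klExt β (tmap 𝕋.T f x) z := by
  apply le_antisymm
  · refine klExt_le_iff.2 ?_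
    rintro w rfl rfl
    have h := klExt_le_iff.1 (le_refl (𝕋.klExt β (tmap 𝕋.T f (tmul 𝕋.T X (tmap 𝕋.T Prod.fst w)))
      (tmap 𝕋.T Prod.snd w))) (tmap 𝕋.T (fun p => (tmap 𝕋.T f p.1, p.2)) w)
      (by rw [← tmul_tmap_tmap]; simp only [tmap_tmap]) (by simp only [tmap_tmap])
    rwa [xiMap_tmap] at h
  · refine klExt_le_iff.2 ?_
    rintro w hw rfl
    obtain ⟨Q, hQ, rfl⟩ := (𝕋.mul_pullback f).2 _ x hw
    obtain ⟨v, rfl, rfl⟩ := exists_lift_fst (𝕋 := 𝕋) (tmap 𝕋.T f) Q w hQ.symm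
    rw [xiMap_tmap]
    rw [tmap_tmap]
    exact le_klExt (fun x' z' => β (tmap 𝕋.T f x') z') v

theorem klExt_comp_le (f : X → Y) (β : 𝕋.T.obj Z → Y → V) (z : 𝕋.T.obj Z) (x : 𝕋.T.obj X) :
    𝕋.klExt (fun z' x' => β z' (f x')) z x ≤ 𝕋.klExt β z (tmap 𝕋.T f x) := by
  refine klExt_le_iff.2 ?_
  rintro w rfl rfl
  have h := le_klExt β (tmap 𝕋.T (fun p => (p.1, f p.2)) w)
  simp only [xiMap_tmap, tmap_tmap] at h ⊢
  exact h

end KleisliConvolution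

/-! ### Distributors and the adjunction between `lower` and `upper` -/

section Distributors

variable {V : Type u} [CommMonoid V] [CompleteLattice V] [IsQuantale V] {𝕋 : TopTheory V}
variable {X Y Z A : TCat 𝕋}

theorem le_kcomp_str (φ : TRel X Y) : φ ≤ 𝕋.kcomp φ X.str := fun x y => by
  refine le_trans ?_ (klExt_mul_le_kcomp φ X.str x x y)
  exact le_mul_of_one_le_left' (one_le_klExt_self X.refl x)

theorem le_str_kcomp (φ : TRel X Y) : φ ≤ 𝕋.kcomp Y.str φ := fun x y => by
  refine le_trans ?_ (klExt_mul_le_kcomp Y.str φ x (tunit 𝕋.T _ y) y)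
  exact (le_klExt_tunit φ x y).trans (le_mul_of_one_le_right' (Y.refl y))

theorem IsDist.kcomp_str {φ : TRel X Y} (h : IsDist X Y φ) : 𝕋.kcomp φ X.str = φ :=
  le_antisymm h.1 (le_kcomp_str φ)

theorem IsDist.str_kcomp {φ : TRel X Y} (h : IsDist X Y φ) : 𝕋.kcomp Y.str φ = φ :=
  le_antisymm h.2 (le_str_kcomp φ)

theorem isDist_str (X : TCat 𝕋) : IsDist X X X.str := by
  have h : 𝕋.kcomp X.str X.str ≤ X.str := fun x y => by
    refine kcomp_le_iff.2 fun z => ?_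
    rw [← Quantale.leftMulResiduation_le_iff_mul_le]
    refine iSup₂_le ?_
    rintro xx rfl
    rw [Quantale.leftMulResiduation_le_iff_mul_le]
    exact X.trans xx z y
  exact ⟨h, h⟩

/-- Write $\varphi=\varphi\circ a$; by `klExt_tmap`, $\hat a$ commutes with restriction along $Tf$.
-/
theorem IsDist.kcomp_lower {φ : TRel X Y} (h : IsDist X Y φ) (f : TFunctor A X) :
    𝕋.kcomp φ f.lower = fun a y => φ (tmap 𝕋.T f.toFun a) y := by
  funext a y
  conv_rhs => rw [← h.kcomp_str]
  simp only [TopTheory.kcomp, ← klExt_tmap]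
  rfl

/-- Write $\varphi$ as its composite with the structure of $Y$; evaluated at $f(a)$, that composite
is by definition $f^*\circ\varphi$. -/
theorem IsDist.upper_kcomp {φ : TRel X Y} (h : IsDist X Y φ) (f : TFunctor A Y) :
    𝕋.kcomp f.upper φ = fun x a => φ x (f.toFun a) := by
  conv_rhs => rw [← h.str_kcomp]
  rfl

namespace TFunctor

theorem ext {f g : TFunctor X Y} (h : f.toFun = g.toFun) : f = g := by
  cases f
  cases g
  cases h
  rfl

theorem isDist_lower (f : TFunctor X Y) : IsDist X Y f.lower := by
  have hY := isDist_str Y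
  have e : f.lower = 𝕋.kcomp Y.str f.lower := (hY.kcomp_lower f).symm
  refine ⟨?_, e.ge⟩
  intro x y
  refine kcomp_le_iff.2 fun z => ?_
  have h1 : 𝕋.klExt X.str x z ≤ 𝕋.klExt Y.str (tmap 𝕋.T f.toFun x) (tmap 𝕋.T f.toFun z) := by
    rw [← klExt_tmap]
    exact (klExt_mono f.functorial x z).trans
      (klExt_comp_le f.toFun (fun x' y' => Y.str (tmap 𝕋.T f.toFun x') y') x z)
  exact (mul_le_mul_left h1 _).trans ((klExt_mul_le_kcomp _ _ _ _ _).trans (hY.1 _ _))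

/-- The unit of $f_*\dashv f^*$: functoriality of $f$ in disguise. -/
theorem str_le_upper_kcomp_lower (f : TFunctor X Y) : X.str ≤ 𝕋.kcomp f.upper f.lower := by
  rw [f.isDist_lower.upper_kcomp]
  exact f.functorial

/-- The counit of $f_*\dashv f^*$: reindexing along $Tf$ reduces it to $b\circ b\le b$. -/
theorem lower_kcomp_upper_le (f : TFunctor X Y) : 𝕋.kcomp f.lower f.upper ≤ Y.str := fun y z =>
  kcomp_le_iff.2 fun x => (mul_le_mul_left (klExt_comp_le f.toFun Y.str y x) _).trans
    ((klExt_mul_le_kcomp Y.str Y.str y _ z).trans ((isDist_str Y).1 y z))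

/-- Adjoints determine each other, with the order reversed; both directions are the usual calculus
of mates. -/
theorem le_iff_lower_le (f g : TFunctor X Y) : f.Le g ↔ g.lower ≤ f.lower := by
  constructor
  · intro h
    calc g.lower ≤ 𝕋.kcomp g.lower X.str := le_kcomp_str _
      _ ≤ 𝕋.kcomp g.lower (𝕋.kcomp g.upper f.lower) := kcomp_mono le_rfl
          (f.str_le_upper_kcomp_lower.trans (kcomp_mono h le_rfl))
      _ = 𝕋.kcomp (𝕋.kcomp g.lower g.upper) f.lower := kcomp_assoc _ _ _
      _ ≤ 𝕋.kcomp Y.str f.lower := kcomp_mono g.lower_kcomp_upper_le le_rfl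
      _ ≤ f.lower := f.isDist_lower.2
  · intro h
    calc f.upper ≤ 𝕋.kcomp X.str f.upper := le_str_kcomp _
      _ ≤ 𝕋.kcomp (𝕋.kcomp g.upper f.lower) f.upper := kcomp_mono
          (g.str_le_upper_kcomp_lower.trans (kcomp_mono le_rfl h)) le_rfl
      _ = 𝕋.kcomp g.upper (𝕋.kcomp f.lower f.upper) := (kcomp_assoc _ _ _).symm
      _ ≤ 𝕋.kcomp g.upper Y.str := kcomp_mono le_rfl f.lower_kcomp_upper_le
      _ ≤ g.upper := fun y x => (isDist_str Y).1 y (g.toFun x)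

theorem equivalent_iff_lower_eq (f g : TFunctor X Y) : f.Equivalent g ↔ f.lower = g.lower := by
  rw [Equivalent, le_iff_lower_le, le_iff_lower_le, and_comm]
  exact le_antisymm_iff.symm

theorem lower_id (X : TCat 𝕋) : (TFunctor.id X).lower = X.str := by
  funext x y
  exact congrArg (X.str · y) (tmap_id x)

theorem lower_comp_apply (g : TFunctor Y Z) (f : TFunctor X Y) (x : 𝕋.T.obj X.carrier)
    (z : Z.carrier) : (g.comp f).lower x z = g.lower (tmap 𝕋.T f.toFun x) z :=
  congrArg (Z.str · z) (tmap_tmap g.toFun f.toFun x).symm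

theorem lower_comp (g : TFunctor Y Z) (f : TFunctor X Y) :
    (g.comp f).lower = 𝕋.kcomp g.lower f.lower := by
  rw [g.isDist_lower.kcomp_lower]
  funext x z
  exact lower_comp_apply g f x z

theorem upper_comp (g : TFunctor Y Z) (f : TFunctor X Y) :
    (g.comp f).upper = 𝕋.kcomp f.upper g.upper := by
  -- $g^*$ absorbs the structure of $Y$. Since $f^*\circ g^*$ at $x$ is by definition this composite
  -- at $f(x)$, both inequalities follow by evaluation there.
  have h : 𝕋.kcomp Y.str g.upper ≤ g.upper := fun z y => by
    refine kcomp_le_iff.2 fun y' => ?_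
    refine (mul_le_mul' (klExt_comp_le g.toFun Z.str z y') (g.functorial y' y)).trans ?_
    exact (klExt_mul_le_kcomp Z.str Z.str z _ _).trans ((isDist_str Z).1 _ _)
  refine le_antisymm ?_ ?_
  · exact fun z x => le_str_kcomp g.upper z (f.toFun x)
  · exact fun z x => h z (f.toFun x)

theorem adjoint_iff (f : TFunctor X Y) (g : TFunctor Y X) : f.Adjoint g ↔ f.lower = g.upper := by
  constructor
  · rintro ⟨h1, h2⟩
    refine le_antisymm (fun x y => ?_) (fun x y => ?_)
    · have h3 := (le_iff_lower_le _ _).1 h1 x (g.toFun y)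
      rw [lower_comp_apply, lower_id] at h3
      exact (g.functorial _ y).trans h3
    · exact (f.functorial x (g.toFun y)).trans (h2 _ y)
  · intro h
    constructor
    · intro x y
      exact (f.functorial x y).trans (congrFun (congrFun h x) (f.toFun y)).le
    · rw [Le, upper_comp, ← h]
      exact f.lower_kcomp_upper_le

end TFunctor

/-- Extending `h_*` along `φ` amounts to extending the structure along `φ ∘ h^*`. -/
theorem kextend_lower_eq {φ : TRel Y Z} (hφ : IsDist Y Z φ) (h : TFunctor Y X) :
    𝕋.kextend h.lower φ = 𝕋.kextend X.str (𝕋.kcomp φ h.upper) := by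
  -- Both sides are compared through the $\delta$ below them: by $h_*\dashv h^*$,
  -- $\delta\circ\varphi\le h_*$ iff $\delta\circ\varphi\circ h^*\le a$.
  refine eq_of_forall_le_iff fun δ => ?_
  rw [le_kextend_iff, le_kextend_iff, kcomp_assoc]
  constructor
  · exact fun h1 => (kcomp_mono h1 le_rfl).trans h.lower_kcomp_upper_le
  · intro h1
    calc 𝕋.kcomp δ φ = 𝕋.kcomp (𝕋.kcomp δ φ) Y.str := by rw [← kcomp_assoc, hφ.kcomp_str]
      _ ≤ 𝕋.kcomp (𝕋.kcomp δ φ) (𝕋.kcomp h.upper h.lower) :=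
          kcomp_mono le_rfl h.str_le_upper_kcomp_lower
      _ = 𝕋.kcomp (𝕋.kcomp (𝕋.kcomp δ φ) h.upper) h.lower := kcomp_assoc _ _ _
      _ ≤ 𝕋.kcomp X.str h.lower := kcomp_mono h1 le_rfl
      _ ≤ h.lower := h.isDist_lower.2

/-! ### The Yoneda functor, suprema and weighted colimits -/

namespace DistClass

variable (Φ : DistClass 𝕋)

/-- A family `i` of presheaves is the same as a relation $X\rightharpoonup S$, and the function
space structure is the extension along it. The Yoneda lemma, the functors `mate` and the colimit
formula all rest on this. -/
theorem phiPsh_str_tmap {S : Type u} (i : S → (Φ.phiPsh X).carrier) (p : 𝕋.T.obj S)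
    (ψ : (Φ.phiPsh X).carrier) :
    (Φ.phiPsh X).str (tmap 𝕋.T i p) ψ =
      𝕋.kextend (presheafRel X ψ.1.1) (fun x s => (i s).1.1 x) p PUnit.unit := by
  refine eq_of_forall_le_iff fun v => ?_
  rw [le_phiPsh_str_iff]
  simp only [TopTheory.kextend, le_iInf_iff,
    Quantale.leftMulResiduation_le_iff_mul_le]
  constructor
  · intro h x
    rw [mul_comm, ← Quantale.leftMulResiduation_le_iff_mul_le, klExt_le_iff]
    rintro w rfl hw
    rw [Quantale.leftMulResiduation_le_iff_mul_le, mul_comm]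
    exact h w hw
  · rintro h q rfl
    exact (mul_le_mul_right (le_klExt (fun x s => (i s).1.1 x) q) v).trans (h _)

/-- The Yoneda lemma. -/
theorem lower_yoneda (X : TCat 𝕋) : (Φ.yoneda X).lower = fun x ψ => ψ.1.1 x := by
  funext x ψ
  have h := phiPsh_str_tmap Φ (Φ.yoneda X).toFun x ψ
  -- What remains is $\psi/a=\psi$: $\psi/a\le(\psi/a)\circ a\le\psi$, and $\psi\le\psi/a$
  -- transposes $\psi\circ a\le\psi$.
  refine h.trans (le_antisymm ?_ ?_)
  · have h1 := le_kextend_iff.1 (le_refl (𝕋.kextend (presheafRel X ψ.1.1) X.str)) x PUnit.unit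
    exact (le_kcomp_str (Y := oneCat 𝕋) _ x PUnit.unit).trans h1
  · exact le_kextend_iff.2 ψ.1.2.1 x PUnit.unit

/-- Pointwise membership suffices, and by the Yoneda lemma $\psi^*\circ\mathsf y_*=\psi\in\Phi$. -/
theorem lower_yoneda_mem (X : TCat 𝕋) : Φ.mem X (Φ.phiPsh X) (Φ.yoneda X).lower := by
  have hd := (Φ.yoneda X).isDist_lower
  refine Φ.pointwise hd fun ψ => ?_
  rw [hd.upper_kcomp, lower_yoneda]
  exact ψ.2

/-- The functor `Y → Φ X` corresponding to a member `φ : X ⇀ Y` of `Φ`. -/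
def mate {φ : TRel X Y} (hφ : Φ.mem X Y φ) : TFunctor Y (Φ.phiPsh X) where
  toFun y :=
    have h : Φ.mem X (oneCat 𝕋) (presheafRel X fun x => φ x y) := by
      have h1 := Φ.upper_comp (pointFunctor Y y) hφ
      rwa [(Φ.isDist hφ).upper_kcomp] at h1
    ⟨⟨fun x => φ x y, Φ.isDist h⟩, h⟩
  functorial y' y := by
    rw [phiPsh_str_tmap]
    -- Functoriality reads $b\le\varphi/\varphi$, the transpose of $b\circ\varphi\le\varphi$.
    exact le_kextend_iff.2 (Φ.isDist hφ).2 y' y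

variable {Φ}

/-- The adjunction says $S_*=\mathsf y^*$, and $\mathsf y^*=a/\mathsf y_*$ is the extension formula
for $\Phi X$ applied to representables. -/
theorem isSup_iff (S : TFunctor (Φ.phiPsh X) X) :
    Φ.IsSup X S ↔ IsColimit (Φ.yoneda X).lower (TFunctor.id X) S := by
  have h : (Φ.yoneda X).upper = 𝕋.kextend X.str (Φ.yoneda X).lower := by
    funext p x
    have h1 := phiPsh_str_tmap Φ (fun ψ => ψ) p ((Φ.yoneda X).toFun x)
    rw [tmap_id] at h1
    rw [lower_yoneda]
    exact h1
  rw [IsSup, TFunctor.adjoint_iff, IsColimit, TFunctor.lower_id, h]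

/-- In the presence of suprema, the colimit of `h` weighted by `φ` is the supremum of `φ ∘ h^*`. -/
theorem IsSup.isColimit {S : TFunctor (Φ.phiPsh X) X} (hS : Φ.IsSup X S) {φ : TRel Y Z}
    (hφ : Φ.mem Y Z φ) (h : TFunctor Y X) :
    IsColimit φ h (S.comp ((Φ.phiMap h).comp (Φ.mate hφ))) := by
  rw [IsColimit, kextend_lower_eq (Φ.isDist hφ)]
  funext z x
  rw [TFunctor.lower_comp_apply, (TFunctor.adjoint_iff _ _).1 hS]
  -- The family $z\mapsto\varphi(-,z)\circ h^*$ is, as a relation, $\varphi\circ h^*$.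
  exact phiPsh_str_tmap Φ _ z ((Φ.yoneda X).toFun x)

theorem phiMap_comp (g : TFunctor Y Z) (f : TFunctor X Y) :
    (Φ.phiMap g).comp (Φ.phiMap f) = Φ.phiMap (g.comp f) := by
  have h : ((Φ.phiMap g).comp (Φ.phiMap f)).toFun = (Φ.phiMap (g.comp f)).toFun := by
    funext ψ
    refine Subtype.ext (Subtype.ext (funext fun z => ?_))
    have h1 := kcomp_assoc (presheafRel X ψ.1.1) f.upper g.upper
    rw [← TFunctor.upper_comp] at h1
    exact (congrFun (congrFun h1 z) PUnit.unit).symm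
  exact TFunctor.ext h

/-! ### Cocontinuity, density and left adjoints -/

theorem Cocomplete.exists_isSup (hX : Φ.Cocomplete X) :
    ∃ S : TFunctor (Φ.phiPsh X) X, Φ.IsSup X S := by
  obtain ⟨S, hS⟩ := hX X (Φ.phiPsh X) _ (TFunctor.id X) (Φ.lower_yoneda_mem X)
  exact ⟨S, (isSup_iff S).2 hS⟩

/-- Both composites are $\mathsf y_*$-weighted colimits of $f$: the first because $f$ preserves the
colimit $\mathrm{Sup}_X$ of $1_X$, the second by the colimit formula in $Y$. -/
theorem Cocontinuous.equivalent {f : TFunctor X Y} (hf : Φ.Cocontinuous f)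
    {SX : TFunctor (Φ.phiPsh X) X} {SY : TFunctor (Φ.phiPsh Y) Y} (hSX : Φ.IsSup X SX)
    (hSY : Φ.IsSup Y SY) : (f.comp SX).Equivalent (SY.comp (Φ.phiMap f)) := by
  have hm := Φ.lower_yoneda_mem X
  rw [TFunctor.equivalent_iff_lower_eq]
  have h1 := hf _ _ _ _ _ hm ((isSup_iff SX).1 hSX)
  -- By the Yoneda lemma the functor classifying $\mathsf y_*$ is the identity of $\Phi X$.
  have h2 : (Φ.mate hm).toFun = fun ψ => ψ := by
    funext ψ
    refine Subtype.ext (Subtype.ext ?_)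
    exact congrArg (fun (r : TRel X (Φ.phiPsh X)) x => r x ψ) (Φ.lower_yoneda X)
  have h3 : (Φ.phiMap f).comp (Φ.mate hm) = Φ.phiMap f := by
    have h4 : ((Φ.phiMap f).comp (Φ.mate hm)).toFun = (Φ.phiMap f).toFun :=
      funext fun ψ => congrArg (Φ.phiMap f).toFun (congrFun h2 ψ)
    exact TFunctor.ext h4
  have h5 := hSY.isColimit hm f
  rw [h3] at h5
  exact Eq.trans h1 h5.symm

/-- Any $\varphi$-weighted colimit of $k$ is equivalent to $\mathrm{Sup}_X\cdot\Phi
k\cdot\ulcorner\varphi\urcorner$. Moving $f$ past $\mathrm{Sup}_X$ and using $\Phi f\cdot\Phi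
k=\Phi(fk)$ gives the colimit formula for $fk$. -/
theorem cocontinuous_of_equivalent {f : TFunctor X Y}
    {SX : TFunctor (Φ.phiPsh X) X} {SY : TFunctor (Φ.phiPsh Y) Y} (hSX : Φ.IsSup X SX)
    (hSY : Φ.IsSup Y SY) (h : (f.comp SX).Equivalent (SY.comp (Φ.phiMap f))) :
    Φ.Cocontinuous f := by
  intro A B φ k g hφ hg
  rw [TFunctor.equivalent_iff_lower_eq] at h
  have h1 := hSY.isColimit hφ (f.comp k)
  rw [← phiMap_comp] at h1
  refine Eq.trans ?_ h1
  have h2 : g.lower = (SX.comp ((Φ.phiMap k).comp (Φ.mate hφ))).lower :=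
    Eq.trans hg (hSX.isColimit hφ k).symm
  calc (f.comp g).lower = (f.comp (SX.comp ((Φ.phiMap k).comp (Φ.mate hφ)))).lower := by
        rw [TFunctor.lower_comp, h2, ← TFunctor.lower_comp]
    _ = ((f.comp SX).comp ((Φ.phiMap k).comp (Φ.mate hφ))).lower := rfl
    _ = ((SY.comp (Φ.phiMap f)).comp ((Φ.phiMap k).comp (Φ.mate hφ))).lower := by
        rw [TFunctor.lower_comp, h, ← TFunctor.lower_comp]

theorem Cocontinuous.isLeftAdjoint {f : TFunctor X Y} (hX : Φ.Cocomplete X)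
    (hf : Φ.Cocontinuous f) (hd : Φ.Dense f) : f.IsLeftAdjoint := by
  obtain ⟨g, hg⟩ := hX X Y f.lower (TFunctor.id X) hd
  have hfg : (f.comp g).lower = 𝕋.kextend f.lower f.lower := hf _ _ _ _ _ hd hg
  refine ⟨g, (TFunctor.le_iff_lower_le _ _).2 ?_, (TFunctor.le_iff_lower_le _ _).2 ?_⟩
  -- The unit is $g_*\circ f_*\le a$, the transpose of $g_*\le a/f_*$; the counit below is $b\le
  -- f_*/f_*$, the transpose of $b\circ f_*\le f_*$.
  · rw [TFunctor.lower_comp]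
    exact le_kextend_iff.1 (le_of_eq hg)
  · rw [hfg, TFunctor.lower_id, le_kextend_iff]
    exact f.isDist_lower.2

theorem dense_of_isLeftAdjoint {f : TFunctor X Y} (h : f.IsLeftAdjoint) : Φ.Dense f := by
  obtain ⟨g, hg⟩ := h
  rw [Dense, (TFunctor.adjoint_iff f g).1 hg]
  exact Φ.upper_mem g

end DistClass

end Distributors

theorem mainTheorem4 {V : Type u} [CommMonoid V] [CompleteLattice V] [IsQuantale V]
    (𝕋 : TopTheory V) (Φ : DistClass 𝕋) (X Y : TCat 𝕋)
    (hX : Φ.Cocomplete X) (hY : Φ.Cocomplete Y) (f : TFunctor X Y) :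
    (∃ SX : TFunctor (Φ.phiPsh X) X, Φ.IsSup X SX) ∧
    (∃ SY : TFunctor (Φ.phiPsh Y) Y, Φ.IsSup Y SY) ∧
    (∀ (SX : TFunctor (Φ.phiPsh X) X) (SY : TFunctor (Φ.phiPsh Y) Y),
      Φ.IsSup X SX → Φ.IsSup Y SY →
      (Φ.Cocontinuous f ↔ (f.comp SX).Equivalent (SY.comp (Φ.phiMap f)))) ∧
    (Φ.Cocontinuous f → (Φ.Dense f ↔ f.IsLeftAdjoint)) :=
  ⟨hX.exists_isSup, hY.exists_isSup, fun _ _ hSX hSY =>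
    ⟨fun hf => hf.equivalent hSX hSY, DistClass.cocontinuous_of_equivalent hSX hSY⟩,
    fun hf => ⟨hf.isLeftAdjoint hX, DistClass.dense_of_isLeftAdjoint⟩⟩
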